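/- For sequences of distinct numbers, say that two sequences of the same length are in the same relative order if, for all positions $a,b$, the entry in position $a$ is smaller than the entry in position $b$ in the first sequence exactly when this is so in the second. Let $\mathcal{S}_n$ be the set of permutations of $\{1,\dots,n\}$, written in one-line notation, and let $\mathcal{P}$ be the consecutive pattern poset: its elements are all permutations in $\bigcup_{n\ge 1}\mathcal{S}_n$, and $\sigma\le\tau$ ("$\tau$ contains $\sigma$") if some block of adjacent entries of $\tau$ is in the same relative order as the sequence of entries of $\sigma$. Let $\mu$ be the Möbius function of $\mathcal{P}$, that is, $\mu(\sigma,\sigma)=1$ and $\mu(\sigma,\tau)=-\sum_{\sigma\le\rho<\tau}\mu(\sigma,\rho)$ for $\sigma<\tau$. For a fixed $\sigma\in\mathcal{P}$, let $\mathbb{P}_n^\sigma(\mu(\sigma,\tau)=0)$ denote the probability that $\mu(\sigma,\tau)=0$ when $\tau$ is chosen uniformly at random among the permutations in $\mathcal{S}_n$ that contain $\sigma$ (this is considered for $n\ge|\sigma|$, where $|\sigma|$ is the length of $\sigma$, so that such permutations exist). Then, for every $\sigma\in\mathcal{P}$, $$\lim_{n\to\infty}\mathbb{P}_n^\sigma(\mu(\sigma,\tau)=0)=1.$$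 -/

import Mathlib

/-- A permutation of positive length `n`, written in one-line notation. Positions and values are
indexed by `Fin n = {0, …, n - 1}` instead of `{1, …, n}`. -/
structure ConsecPerm where
  /-- The length of the permutation. -/
  len : ℕ
  /-- There is no empty permutation. -/
  len_pos : 0 < len
  /-- The underlying permutation, sending a position to the entry at that position. -/
  perm : Equiv.Perm (Fin len)

namespace ConsecPerm

/-- `σ.OccursAt τ i` says that the window of `σ.len` adjacent entries of `τ` that begins at
position `i` lies inside `τ` and is in the same relative order as the entries of `σ`, that is,
its reduction is `σ`. -/
def OccursAt (σ τ : ConsecPerm) (i : ℕ) : Prop :=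
  ∃ h : i + σ.len ≤ τ.len, ∀ a b : Fin σ.len,
    σ.perm a < σ.perm b ↔
      τ.perm ⟨i + a, by have := a.isLt; omega⟩ < τ.perm ⟨i + b, by have := b.isLt; omega⟩

/-- Consecutive pattern containment: `σ ≤ τ` if `σ` occurs somewhere in `τ`. -/
instance : LE ConsecPerm where
  le σ τ := ∃ i : ℕ, σ.OccursAt τ i

theorem le_def {σ τ : ConsecPerm} : σ ≤ τ ↔ ∃ i : ℕ, σ.OccursAt τ i := Iff.rfl

theorem len_le_of_le {σ τ : ConsecPerm} (h : σ ≤ τ) : σ.len ≤ τ.len := by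
  obtain ⟨i, hi, -⟩ := h
  omega

/-- A permutation of a finite initial segment is determined by the relative order of its
entries. -/
theorem perm_eq_of_lt_iff {n : ℕ} {p q : Equiv.Perm (Fin n)}
    (h : ∀ a b, p a < p b ↔ q a < q b) : p = q := by
  have hm : StrictMono (fun x => q (p.symm x)) := by
    intro x y hxy
    have := h (p.symm x) (p.symm y)
    simp only [Equiv.apply_symm_apply] at this
    exact this.1 hxy
  have hid : (fun x => q (p.symm x)) = id := by
    refine (StrictMono.range_inj hm strictMono_id).1 ?_
    rw [Set.range_id]
    exact (p.symm.trans q).surjective.range_eq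
  ext a
  have := congrFun hid (p a)
  simp only [Equiv.symm_apply_apply, id] at this
  rw [this]

/-- The consecutive pattern poset. -/
instance : PartialOrder ConsecPerm where
  le_refl σ := ⟨0, by omega, fun a b => by simp⟩
  le_trans σ τ ρ := by
    rintro ⟨i, hi, h⟩ ⟨j, hj, k⟩
    refine ⟨j + i, by omega, fun a b => ?_⟩
    rw [h, k]
    simp only [add_assoc]
  le_antisymm σ τ h₁ h₂ := by
    have hl := le_antisymm (len_le_of_le h₁) (len_le_of_le h₂)
    obtain ⟨n, hn, p⟩ := σ
    obtain ⟨m, hm, q⟩ := τ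
    obtain rfl : n = m := hl
    obtain ⟨i, hi, h⟩ := h₁
    obtain rfl : i = 0 := by simpa using hi
    congr 1
    refine perm_eq_of_lt_iff fun a b => ?_
    simpa using h a b

theorem finite_len_le (n : ℕ) : {τ : ConsecPerm | τ.len ≤ n}.Finite := by
  let f : (Σ k : Fin n, Equiv.Perm (Fin (k.val + 1))) → ConsecPerm :=
    fun x => ⟨x.1.val + 1, Nat.succ_pos _, x.2⟩
  refine (Set.finite_range f).subset ?_
  rintro ⟨m, hm, p⟩ h
  obtain ⟨k, rfl⟩ : ∃ k, m = k + 1 := ⟨m - 1, by omega⟩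
  exact ⟨⟨⟨k, h⟩, p⟩, rfl⟩

noncomputable instance : LocallyFiniteOrder ConsecPerm :=
  LocallyFiniteOrder.ofFiniteIcc fun _ τ =>
    (finite_len_le τ.len).subset fun _ h => len_le_of_le h.2

noncomputable instance : DecidableEq ConsecPerm := Classical.decEq _

/-- The Möbius function of the consecutive pattern poset. -/
noncomputable def mobius (σ τ : ConsecPerm) : ℤ := IncidenceAlgebra.mu ℤ σ τ

/-- The set of permutations of length `n` that contain `σ`. -/
def containing (σ : ConsecPerm) (n : ℕ) : Set ConsecPerm := {τ | τ.len = n ∧ σ ≤ τ}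

theorem finite_containing (σ : ConsecPerm) (n : ℕ) : (σ.containing n).Finite :=
  (finite_len_le n).subset fun _ h => h.1.le

/-- The probability of the event `E` when `τ` is chosen uniformly at random in the finite set
`σ.containing n`. -/
noncomputable def probContaining (σ : ConsecPerm) (n : ℕ) (E : Set ConsecPerm) : ℝ :=
  ((σ.containing n ∩ E).ncard : ℝ) / ((σ.containing n).ncard : ℝ)

end ConsecPerm

section

open Finset Equiv

/-! A proper subpattern of `τ` lies in `τ` minus its last entry or in `τ` minus its first. If every
bifix of `τ` also occurs in the interior, the patterns below both are those below the interior, so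
inclusion-exclusion gives `μ(σ,τ) = 0` once `τ` is long enough (`mobius_eq_zero`). Random
permutations satisfy this hypothesis. A fixed pattern fails to occur inside with exponentially small
frequency (`freq_not_occursInside_le`), which handles the finitely many short bifixes. A long bifix
forces a self-similarity, whose frequency is bounded by a tail of `∑ 1/d!` (`freq_long_bifix_le`).
The same estimate for `σ` shows that almost all permutations contain `σ`, so conditioning on this is
harmless. -/

theorem Equiv.Perm.exists_lt_iff_lt {m : ℕ} {α : Type*} [LinearOrder α] {f : Fin m → α}
    (hf : Function.Injective f) : ∃ s : Perm (Fin m), ∀ a b, s a < s b ↔ f a < f b := by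
  have hm : StrictMono (f ∘ Tuple.sort f) :=
    (Tuple.monotone_sort f).strictMono_of_injective (hf.comp (Tuple.sort f).injective)
  refine ⟨(Tuple.sort f)⁻¹, fun a b => ?_⟩
  have h := hm.lt_iff_lt (a := (Tuple.sort f)⁻¹ a) (b := (Tuple.sort f)⁻¹ b)
  simpa using h.symm

/-! ### Counting permutations by averaging over translates -/

/-- If for every `x` at most `c` of the translates `x * g i` lie in `E`, then `E` has density at
most `c / |ι|`. -/
theorem card_mul_card_le_of_translates {G ι : Type*} [Group G] [Fintype G] [DecidableEq G]
    [Fintype ι] (g : ι → G) (E : Finset G) (c : ℕ) (h : ∀ x, #{i | x * g i ∈ E} ≤ c) :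
    Fintype.card ι * #E ≤ c * Fintype.card G := by
  -- Double count the pairs `(x, i)` with `x * g i ∈ E`; right translation is bijective, so each `i`
  -- contributes `#E`.
  have key := sum_card_bipartiteAbove_eq_sum_card_bipartiteBelow
    (s := (univ : Finset G)) (t := (univ : Finset ι)) (fun x i => x * g i ∈ E)
  have h₁ : ∀ i ∈ (univ : Finset ι),
      #(bipartiteBelow (fun x i => x * g i ∈ E) (univ : Finset G) i) = #E := by
    intro i _
    refine card_bij' (fun x _ => x * g i) (fun y _ => y * (g i)⁻¹) ?_ ?_ ?_ ?_ <;>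
      simp [bipartiteBelow]
  rw [sum_congr rfl h₁, sum_const, card_univ, smul_eq_mul] at key
  rw [← key, mul_comm c, ← card_univ (α := G), ← smul_eq_mul (#univ)]
  exact sum_le_card_nsmul _ _ _ fun x _ => h x

/-- Few permutations have the same relative order along two disjoint families of positions. -/
theorem Equiv.Perm.card_same_order_le {m : ℕ} {α : Type*} [Fintype α] [LinearOrder α]
    (ι κ : Fin m ↪ α) (hd : ∀ a b, ι a ≠ κ b) :
    m.factorial * #{p : Perm α | ∀ a b, p (ι a) < p (ι b) ↔ p (κ a) < p (κ b)} ≤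
      (Fintype.card α).factorial := by
  have h := card_mul_card_le_of_translates (fun π : Perm (Fin m) => π.viaEmbedding ι)
    {p : Perm α | ∀ a b, p (ι a) < p (ι b) ↔ p (κ a) < p (κ b)} 1 ?_
  · simpa [Fintype.card_perm] using h
  intro x
  refine card_le_one.2 fun π hπ π' hπ' => ?_
  have hκ : ∀ (π : Perm (Fin m)) a, π.viaEmbedding ι (κ a) = κ a := fun π a =>
    Perm.viaEmbedding_apply_of_notMem _ _ _ (by rintro ⟨b, hb⟩; exact hd _ _ hb)
  simp only [mem_filter, mem_univ, true_and, Perm.mul_apply, Perm.viaEmbedding_apply, hκ]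
    at hπ hπ'
  -- Shuffling along `ι` leaves the order along `κ` fixed, and that order determines `s * π`.
  obtain ⟨s, hs⟩ := Perm.exists_lt_iff_lt (f := fun a => x (ι a))
    (x.injective.comp ι.injective)
  have : s * π = s * π' := ConsecPerm.perm_eq_of_lt_iff fun a b => by
    simp only [Perm.mul_apply, hs, hπ, hπ']
  exact mul_left_cancel this

/-- Few permutations avoid a pattern along many disjoint families of positions. -/
theorem Equiv.Perm.card_avoid_le {q l : ℕ} {α : Type*} [Fintype α] [LinearOrder α]
    (ρ : Perm (Fin l)) (ι : Fin q × Fin l ↪ α) :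
    l.factorial ^ q *
        #{p : Perm α | ∀ j, ¬ ∀ a b, ρ a < ρ b ↔ p (ι (j, a)) < p (ι (j, b))} ≤
      (l.factorial - 1) ^ q * (Fintype.card α).factorial := by
  have h := card_mul_card_le_of_translates
    (fun π : Fin q → Perm (Fin l) => Perm.viaEmbedding (prodCongrRight π) ι)
    {p : Perm α | ∀ j, ¬ ∀ a b, ρ a < ρ b ↔ p (ι (j, a)) < p (ι (j, b))}
    ((l.factorial - 1) ^ q) ?_
  · simpa [Fintype.card_perm] using h
  intro x
  choose s hs using fun j => Perm.exists_lt_iff_lt (f := fun a => x (ι (j, a)))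
    (x.injective.comp (ι.injective.comp (Prod.mk_right_injective j)))
  -- Avoidance in block `j` rules out exactly one value of `π j`.
  calc _ ≤ #(Fintype.piFinset fun j => (univ : Finset (Perm (Fin l))).erase ((s j)⁻¹ * ρ)) := by
        refine card_le_card fun π hπ => ?_
        simp only [mem_filter, mem_univ, true_and, Perm.mul_apply, Perm.viaEmbedding_apply,
          prodCongrRight_apply] at hπ
        simp only [Fintype.mem_piFinset, mem_erase, mem_univ, and_true]
        intro j hj
        refine hπ j fun a b => ?_
        rw [← hs j, hj]
        simp
    _ = _ := by simp [Fintype.card_perm]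

namespace ConsecPerm

/-! ### Windows and occurrences -/

/-- The entry of `τ` at position `i`, with a default value outside `τ`. -/
def entry (τ : ConsecPerm) (i : ℕ) : ℕ := if h : i < τ.len then τ.perm ⟨i, h⟩ else 0

theorem entry_of_lt {τ : ConsecPerm} {i : ℕ} (h : i < τ.len) : τ.entry i = τ.perm ⟨i, h⟩ :=
  dif_pos h

theorem occursAt_iff {σ τ : ConsecPerm} {i : ℕ} :
    σ.OccursAt τ i ↔ i + σ.len ≤ τ.len ∧ ∀ a < σ.len, ∀ b < σ.len,
      (σ.entry a < σ.entry b ↔ τ.entry (i + a) < τ.entry (i + b)) := by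
  constructor
  · rintro ⟨h, H⟩
    refine ⟨h, fun a ha b hb => ?_⟩
    rw [entry_of_lt ha, entry_of_lt hb, entry_of_lt (by omega : i + a < τ.len),
      entry_of_lt (by omega : i + b < τ.len)]
    exact H ⟨a, ha⟩ ⟨b, hb⟩
  · rintro ⟨h, H⟩
    refine ⟨h, fun a b => ?_⟩
    have := H a a.2 b b.2
    rwa [entry_of_lt a.2, entry_of_lt b.2, entry_of_lt (by omega : i + a < τ.len),
      entry_of_lt (by omega : i + b < τ.len)] at this

theorem exists_occursAt {τ : ConsecPerm} {i m : ℕ} (hm : 0 < m) (h : i + m ≤ τ.len) :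
    ∃ ρ : ConsecPerm, ρ.len = m ∧ ρ.OccursAt τ i := by
  obtain ⟨s, hs⟩ := Perm.exists_lt_iff_lt
    (f := fun a : Fin m => τ.perm ⟨i + a, by have := a.isLt; omega⟩)
    (fun a b hab => by simpa [Fin.ext_iff] using hab)
  exact ⟨⟨m, hm, s⟩, rfl, h, hs⟩

theorem eq_of_occursAt {σ ρ τ : ConsecPerm} {i : ℕ} (hl : σ.len = ρ.len) (hσ : σ.OccursAt τ i)
    (hρ : ρ.OccursAt τ i) : σ = ρ := by
  obtain ⟨n, hn, p⟩ := σ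
  obtain ⟨m, hm, q⟩ := ρ
  obtain rfl : n = m := hl
  obtain ⟨_, h⟩ := hσ
  obtain ⟨_, k⟩ := hρ
  congr 1
  exact perm_eq_of_lt_iff fun a b => (h a b).trans (k a b).symm

theorem OccursAt.trans {ρ σ τ : ConsecPerm} {i j : ℕ} (h : ρ.OccursAt σ i)
    (k : σ.OccursAt τ j) : ρ.OccursAt τ (j + i) := by
  rw [occursAt_iff] at *
  refine ⟨by omega, fun a ha b hb => ?_⟩
  rw [h.2 a ha b hb, k.2 (i + a) (by omega) (i + b) (by omega), add_assoc, add_assoc]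

theorem OccursAt.of_window {ρ σ τ : ConsecPerm} {i j : ℕ} (h : ρ.OccursAt τ i)
    (k : σ.OccursAt τ j) (hj : j ≤ i) (hl : i + ρ.len ≤ j + σ.len) : ρ ≤ σ := by
  obtain ⟨e, rfl⟩ := Nat.exists_eq_add_of_le hj
  refine ⟨e, ?_⟩
  rw [occursAt_iff] at *
  refine ⟨by omega, fun a ha b hb => ?_⟩
  rw [h.2 a ha b hb, k.2 (e + a) (by omega) (e + b) (by omega), add_assoc, add_assoc]

/-! ### Bifixes and vanishing of the Möbius function -/

/-- `ρ` occurs in `τ` without using the first or the last entry. -/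
def OccursInside (ρ τ : ConsecPerm) : Prop :=
  ∃ j, 1 ≤ j ∧ j + ρ.len + 1 ≤ τ.len ∧ ρ.OccursAt τ j

/-- `ρ` is a proper prefix pattern as well as a proper suffix pattern of `τ`. -/
def IsBifix (ρ τ : ConsecPerm) : Prop :=
  ρ.len < τ.len ∧ ρ.OccursAt τ 0 ∧ ρ.OccursAt τ (τ.len - ρ.len)

/-- If all bifixes of `τ` occur in its interior, then the interior is the meet of the two
permutations covered by `τ`, and the Möbius function vanishes below rank distance three. -/
theorem mobius_eq_zero {σ τ : ConsecPerm} (hl : σ.len + 3 ≤ τ.len)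
    (hb : ∀ ρ : ConsecPerm, ρ.IsBifix τ → ρ.OccursInside τ) : mobius σ τ = 0 := by
  by_cases hστ : σ ≤ τ
  swap
  · exact IncidenceAlgebra.apply_eq_zero_of_not_le hστ _
  obtain ⟨p, hp, op⟩ := exists_occursAt (τ := τ) (i := 0) (m := τ.len - 1) (by omega) (by omega)
  obtain ⟨s, hs, os⟩ := exists_occursAt (τ := τ) (i := 1) (m := τ.len - 1) (by omega) (by omega)
  obtain ⟨t, ht, ot⟩ := exists_occursAt (τ := τ) (i := 1) (m := τ.len - 2) (by omega) (by omega)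
  have htp : t ≤ p := ot.of_window op (by omega) (by omega)
  have hts : t ≤ s := ot.of_window os (by omega) (by omega)
  have hU : Ico σ τ = Icc σ p ∪ Icc σ s := by
    ext ρ
    simp only [mem_Ico, mem_union, mem_Icc]
    constructor
    · rintro ⟨h₁, h₂⟩
      obtain ⟨i, hi⟩ := h₂.le
      have hil := hi.1
      have hlt : ρ.len < τ.len := by
        refine lt_of_le_of_ne (by omega) fun he => h₂.ne ?_
        obtain rfl : i = 0 := by omega
        exact eq_of_occursAt he hi ⟨by omega, fun a b => by simp⟩
      rcases Nat.eq_zero_or_pos i with rfl | h0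
      · exact .inl ⟨h₁, hi.of_window op le_rfl (by omega)⟩
      · exact .inr ⟨h₁, hi.of_window os h0 (by omega)⟩
    · have key : ∀ r : ConsecPerm, r.len = τ.len - 1 → r ≤ τ → ρ ≤ r → ρ < τ :=
        fun r hr h₁ h₂ => lt_of_le_of_ne (h₂.trans h₁) fun he => by
          have := len_le_of_le h₂
          rw [he] at this
          omega
      rintro (⟨h₁, h₂⟩ | ⟨h₁, h₂⟩)
      · exact ⟨h₁, key p hp ⟨0, op⟩ h₂⟩
      · exact ⟨h₁, key s hs ⟨1, os⟩ h₂⟩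
  have hI : Icc σ p ∩ Icc σ s = Icc σ t := by
    ext ρ
    simp only [mem_inter, mem_Icc]
    constructor
    · rintro ⟨⟨h₁, i, hi⟩, -, j, hj⟩
      refine ⟨h₁, ?_⟩
      have hil := hi.1
      have hjl := hj.1
      have hi' := hi.trans op
      have hj' := hj.trans os
      -- Unless one of the two occurrences is already interior, they are a prefix and a suffix of
      -- `τ`, so `ρ` is a bifix.
      obtain ⟨e, he, hel, oe⟩ : ρ.OccursInside τ := by
        rcases Nat.eq_zero_or_pos i with rfl | h0
        · rcases Nat.lt_or_ge (1 + j + ρ.len) τ.len with h | h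
          · exact ⟨1 + j, by omega, h, hj'⟩
          · refine hb ρ ⟨by omega, by simpa using hi', ?_⟩
            rwa [show τ.len - ρ.len = 1 + j by omega]
        · exact ⟨0 + i, by omega, by omega, hi'⟩
      exact oe.of_window ot he (by omega)
    · exact fun ⟨h₁, h₂⟩ => ⟨⟨h₁, h₂.trans htp⟩, h₁, h₂.trans hts⟩
  have hne : ∀ r : ConsecPerm, τ.len - 2 ≤ r.len → σ ≠ r := by
    rintro r hr rfl
    omega
  -- The sums over the three closed intervals vanish, since `p`, `s` and `t` are all longer than
  -- `σ`.
  have h := sum_union_inter (s₁ := Icc σ p) (s₂ := Icc σ s)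
    (f := fun x => IncidenceAlgebra.mu ℤ σ x)
  rw [← hU, hI, IncidenceAlgebra.sum_Icc_mu_right, IncidenceAlgebra.sum_Icc_mu_right,
    IncidenceAlgebra.sum_Icc_mu_right, if_neg (hne p (by omega)), if_neg (hne s (by omega)),
    if_neg (hne t (by omega))] at h
  rw [mobius, IncidenceAlgebra.mu_eq_neg_sum_Ico_of_ne (hne τ (by omega))]
  linarith

/-! ### Frequencies and interior occurrences -/

/-- The proportion of permutations of length `n` that satisfy `P`. -/
noncomputable def freq (n : ℕ) (P : ConsecPerm → Prop) : ℝ :=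
  ({τ | τ.len = n ∧ P τ}.ncard : ℝ) / n.factorial

theorem finite_len_eq_and (n : ℕ) (P : ConsecPerm → Prop) :
    {τ : ConsecPerm | τ.len = n ∧ P τ}.Finite :=
  (finite_len_le n).subset fun _ h => h.1.le

open Classical in
theorem ncard_len_eq_and {n : ℕ} (hn : 0 < n) (P : ConsecPerm → Prop) :
    {τ : ConsecPerm | τ.len = n ∧ P τ}.ncard = #{p : Perm (Fin n) | P ⟨n, hn, p⟩} := by
  rw [← Set.ncard_coe_finset]
  symm
  refine Set.ncard_congr (fun p _ => ⟨n, hn, p⟩) ?_ ?_ ?_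
  · intro p hp
    exact ⟨rfl, by simpa using hp⟩
  · intro p q _ _ h
    simpa using h
  · rintro ⟨m, hm, p⟩ ⟨rfl, h⟩
    exact ⟨p, by simpa using h, rfl⟩

theorem freq_nonneg (n : ℕ) (P : ConsecPerm → Prop) : 0 ≤ freq n P := by
  unfold freq; positivity

theorem freq_mono {n : ℕ} {P Q : ConsecPerm → Prop} (h : ∀ τ, τ.len = n → P τ → Q τ) :
    freq n P ≤ freq n Q := by
  unfold freq
  refine div_le_div_of_nonneg_right ?_ (Nat.cast_nonneg _)
  have hs : {τ | τ.len = n ∧ P τ} ⊆ {τ | τ.len = n ∧ Q τ} := fun τ hτ => ⟨hτ.1, h τ hτ.1 hτ.2⟩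
  exact_mod_cast Set.ncard_le_ncard hs (finite_len_eq_and n Q)

theorem freq_or_le (n : ℕ) (P Q : ConsecPerm → Prop) :
    freq n (fun τ => P τ ∨ Q τ) ≤ freq n P + freq n Q := by
  unfold freq
  rw [← add_div]
  gcongr
  have h : {τ : ConsecPerm | τ.len = n ∧ (P τ ∨ Q τ)} =
      {τ | τ.len = n ∧ P τ} ∪ {τ | τ.len = n ∧ Q τ} := by
    ext τ; simp [and_or_left]
  rw [h]
  exact_mod_cast Set.ncard_union_le _ _

theorem freq_exists_le {ι : Type*} (n : ℕ) (s : Finset ι) (P : ι → ConsecPerm → Prop) :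
    freq n (fun τ => ∃ i ∈ s, P i τ) ≤ ∑ i ∈ s, freq n (P i) := by
  classical
  induction s using Finset.induction_on with
  | empty => simp [freq]
  | insert a s ha ih =>
    rw [sum_insert ha]
    refine le_trans ?_ (add_le_add le_rfl ih)
    simpa using freq_or_le n (P a) (fun τ => ∃ i ∈ s, P i τ)

theorem freq_true {n : ℕ} (hn : 0 < n) : freq n (fun _ => True) = 1 := by
  classical
  rw [freq, ncard_len_eq_and hn]
  simp [Fintype.card_perm, Nat.factorial_ne_zero]

/-- The `n - 2` interior positions hold `(n - 2) / ρ.len` disjoint blocks, whose relative orders are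
independent and uniform. -/
theorem freq_not_occursInside_le (ρ : ConsecPerm) {n : ℕ} (hn : 2 ≤ n) :
    freq n (fun τ => ¬ ρ.OccursInside τ) ≤
      (1 - 1 / (ρ.len.factorial : ℝ)) ^ ((n - 2) / ρ.len) := by
  classical
  set q := (n - 2) / ρ.len with hq
  have hql : q * ρ.len ≤ n - 2 := Nat.div_mul_le_self _ _
  have hlt : ∀ x : Fin (q * ρ.len), 1 + x.val < n := fun x => by have := x.isLt; omega
  let ι : Fin q × Fin ρ.len ↪ Fin n :=
    ⟨fun x => ⟨1 + finProdFinEquiv x, hlt _⟩, fun x y h => by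
      simpa [Fin.val_inj, -finProdFinEquiv_apply_val] using h⟩
  have h := Perm.card_avoid_le ρ.perm ι
  have hF : (0 : ℝ) < ρ.len.factorial := by positivity
  have hF1 : 1 ≤ ρ.len.factorial := Nat.factorial_pos _
  have hE : freq n (fun τ => ¬ ρ.OccursInside τ) ≤
      (#{p : Perm (Fin n) | ∀ j, ¬ ∀ a b, ρ.perm a < ρ.perm b ↔
        p (ι (j, a)) < p (ι (j, b))} : ℝ) / n.factorial := by
    rw [freq, ncard_len_eq_and (by omega : 0 < n)]
    gcongr with p
    intro hp j hj
    have hle : 1 + ρ.len * j.val + ρ.len + 1 ≤ n := by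
      have : (j.val + 1) * ρ.len ≤ q * ρ.len := Nat.mul_le_mul_right _ j.isLt
      have e : (j.val + 1) * ρ.len = ρ.len * j.val + ρ.len := by ring
      omega
    refine hp ⟨1 + ρ.len * j.val, by omega, hle, ?_, ?_⟩
    · change _ ≤ n
      omega
    · intro a b
      convert hj a b using 4 <;> simp [ι] <;> omega
  refine hE.trans ?_
  rw [div_le_iff₀ (by positivity)]
  have h' : ((ρ.len.factorial : ℝ)) ^ q * (#{p : Perm (Fin n) | ∀ j, ¬ ∀ a b,
      ρ.perm a < ρ.perm b ↔ p (ι (j, a)) < p (ι (j, b))} : ℝ) ≤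
      ((ρ.len.factorial : ℝ) - 1) ^ q * n.factorial := by
    rw [Fintype.card_fin] at h
    have := (Nat.cast_le (α := ℝ)).2 h
    push_cast [hF1] at this
    exact this
  rw [one_sub_div hF.ne', div_pow, div_mul_eq_mul_div, le_div_iff₀ (by positivity)]
  linarith

theorem tendsto_freq_not_occursInside (ρ : ConsecPerm) :
    Filter.Tendsto (fun n => freq n fun τ => ¬ ρ.OccursInside τ) Filter.atTop (nhds 0) := by
  have hF1 : (1 : ℝ) ≤ ρ.len.factorial := by exact_mod_cast Nat.factorial_pos _
  have h0 : (0 : ℝ) ≤ 1 - 1 / (ρ.len.factorial : ℝ) := by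
    rw [sub_nonneg, div_le_one (by positivity)]; exact hF1
  have h1 : 1 - 1 / (ρ.len.factorial : ℝ) < 1 := by
    have : (0 : ℝ) < 1 / (ρ.len.factorial : ℝ) := by positivity
    linarith
  have hq : Filter.Tendsto (fun n => (n - 2) / ρ.len) Filter.atTop Filter.atTop :=
    (Nat.tendsto_div_const_atTop ρ.len_pos.ne').comp (Filter.tendsto_sub_atTop_nat 2)
  refine squeeze_zero' (.of_forall fun n => freq_nonneg _ _) ?_
    ((tendsto_pow_atTop_nhds_zero_of_lt_one h0 h1).comp hq)
  filter_upwards [Filter.eventually_ge_atTop 2] with n hn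
  exact freq_not_occursInside_le ρ hn

/-! ### Self-similarity and long bifixes -/

/-- The windows of `m` entries of `τ` starting at `0` and at `d` have the same relative order. -/
def SelfSimilar (d m : ℕ) (τ : ConsecPerm) : Prop :=
  ∀ a < m, ∀ b < m, (τ.entry a < τ.entry b ↔ τ.entry (d + a) < τ.entry (d + b))

theorem SelfSimilar.mono {d m m' : ℕ} {τ : ConsecPerm} (h : SelfSimilar d m τ) (hm : m' ≤ m) :
    SelfSimilar d m' τ :=
  fun a ha b hb => h a (by omega) b (by omega)

theorem SelfSimilar.add {d e n : ℕ} {τ : ConsecPerm} (h : SelfSimilar d (n - d) τ)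
    (k : SelfSimilar e (n - e) τ) : SelfSimilar (d + e) (n - (d + e)) τ := by
  intro a ha b hb
  rw [h a (by omega) b (by omega), k (d + a) (by omega) (d + b) (by omega)]
  rw [show e + (d + a) = d + e + a by ring, show e + (d + b) = d + e + b by ring]

theorem SelfSimilar.mul {d n : ℕ} {τ : ConsecPerm} (h : SelfSimilar d (n - d) τ) (k : ℕ) :
    SelfSimilar (d * k) (n - d * k) τ := by
  induction k with
  | zero => intro a _ b _; simp
  | succ k ih => exact ih.add h

theorem IsBifix.selfSimilar {ρ τ : ConsecPerm} (h : ρ.IsBifix τ) :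
    SelfSimilar (τ.len - ρ.len) ρ.len τ := by
  obtain ⟨-, h₁, h₂⟩ := h
  rw [occursAt_iff] at h₁ h₂
  intro a ha b hb
  rw [← h₂.2 a ha b hb, h₁.2 a ha b hb, zero_add, zero_add]

/-- Since `m ≤ d`, the two windows are disjoint, and each order of the first is equally likely given
the second. -/
theorem freq_selfSimilar_le {n d m : ℕ} (hn : 0 < n) (hm : m ≤ d) (hd : d + m ≤ n) :
    freq n (SelfSimilar d m) ≤ 1 / m.factorial := by
  classical
  let ι : Fin m ↪ Fin n := ⟨fun a => ⟨a, by have := a.isLt; omega⟩, fun a b h => by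
    simpa [Fin.ext_iff] using h⟩
  let κ : Fin m ↪ Fin n := ⟨fun a => ⟨d + a, by have := a.isLt; omega⟩, fun a b h => by
    simpa [Fin.ext_iff] using h⟩
  have h := Perm.card_same_order_le ι κ fun a b hab => by
    have := a.isLt
    have : (a : ℕ) = d + b := congrArg Fin.val hab
    omega
  rw [freq, ncard_len_eq_and hn, div_le_div_iff₀ (by positivity) (by positivity), one_mul,
    mul_comm]
  rw [Fintype.card_fin] at h
  refine le_trans ?_ (Nat.cast_le (α := ℝ).2 h)
  push_cast
  gcongr with p
  intro hp a b
  have := hp a a.2 b b.2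
  rwa [entry_of_lt (by change (a : ℕ) < n; omega), entry_of_lt (by change (b : ℕ) < n; omega),
    entry_of_lt (by change d + (a : ℕ) < n; omega),
    entry_of_lt (by change d + (b : ℕ) < n; omega)] at this

/-- A long bifix forces a self-similarity with shift bounded away from `0` and `n`. -/
theorem IsBifix.exists_selfSimilar {ρ τ : ConsecPerm} (h : ρ.IsBifix τ) {L : ℕ}
    (hL : L ≤ ρ.len) (hn : 3 * L ≤ τ.len) :
    ∃ d ∈ Icc L (τ.len - L), SelfSimilar d (τ.len - d) τ := by
  have hlt := h.1
  have hs := h.selfSimilar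
  set d := τ.len - ρ.len with hd
  rw [show ρ.len = τ.len - d by omega] at hs
  rcases le_or_gt L d with hLd | hLd
  · exact ⟨d, mem_Icc.2 ⟨hLd, by omega⟩, hs⟩
  -- The least multiple of `d` exceeding `L` is below `2 * L`, hence at most `τ.len - L`.
  · refine ⟨d * (L / d + 1), mem_Icc.2 ?_, hs.mul _⟩
    have h₁ := Nat.lt_mul_div_succ L (show 0 < d by omega)
    have h₂ := Nat.mul_div_le L d
    rw [mul_add, mul_one] at *
    omega

theorem freq_long_bifix_le {n L : ℕ} (hn : 0 < n) (hL : 3 * L ≤ n) :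
    freq n (fun τ => ∃ ρ : ConsecPerm, L ≤ ρ.len ∧ ρ.IsBifix τ) ≤
      2 * ∑ d ∈ Icc L (n - L), 1 / (d.factorial : ℝ) := by
  calc _ ≤ freq n (fun τ => ∃ d ∈ Icc L (n - L), SelfSimilar d (n - d) τ) := by
        refine freq_mono ?_
        rintro τ rfl ⟨ρ, hρ, hb⟩
        exact hb.exists_selfSimilar hρ hL
    _ ≤ ∑ d ∈ Icc L (n - L), freq n (SelfSimilar d (n - d)) := freq_exists_le _ _ _
    -- Windows of length `min d (n - d)` do not overlap; the sum of both terms covers either case.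
    _ ≤ ∑ d ∈ Icc L (n - L), (1 / (d.factorial : ℝ) + 1 / ((n - d).factorial : ℝ)) := by
        refine sum_le_sum fun d hd => ?_
        rw [mem_Icc] at hd
        have p₁ : (0 : ℝ) ≤ 1 / (d.factorial : ℝ) := by positivity
        have p₂ : (0 : ℝ) ≤ 1 / ((n - d).factorial : ℝ) := by positivity
        rcases le_total d (n - d) with h | h
        · have := (freq_mono fun τ _ hτ => SelfSimilar.mono hτ h).trans
            (freq_selfSimilar_le hn le_rfl (by omega : d + d ≤ n))
          linarith
        · have := freq_selfSimilar_le hn h (by omega : d + (n - d) ≤ n)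
          linarith
    _ = _ := by
        rw [sum_add_distrib, two_mul]
        congr 1
        refine sum_bij' (fun d _ => n - d) (fun d _ => n - d) ?_ ?_ ?_ ?_ ?_ <;>
          intro d hd <;> simp only [mem_Icc] at * <;> omega

/-! ### Passage to the limit -/

theorem tendsto_freq_bifix_not_occursInside :
    Filter.Tendsto
      (fun n => freq n fun τ => ∃ ρ : ConsecPerm, ρ.IsBifix τ ∧ ¬ ρ.OccursInside τ)
      Filter.atTop (nhds 0) := by
  refine tendsto_order.2 ⟨fun a ha => .of_forall fun n => ha.trans_le (freq_nonneg _ _),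
    fun ε hε => ?_⟩
  have hsum : Summable fun d : ℕ => 1 / (d.factorial : ℝ) := by
    simpa using Real.summable_pow_div_factorial 1
  -- The tail enters with a factor 2, so `ε / 4` leaves `ε / 2` for the short bifixes.
  obtain ⟨s, hs⟩ := summable_iff_vanishing_norm.1 hsum (ε / 4) (by positivity)
  set L := s.sup id + 1 with hL
  have hshort : Filter.Tendsto (fun n => ∑ ρ ∈ (finite_len_le L).toFinset,
      freq n fun τ => ¬ ρ.OccursInside τ) Filter.atTop (nhds 0) := by
    simpa using tendsto_finsetSum (finite_len_le L).toFinset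
      fun ρ _ => tendsto_freq_not_occursInside ρ
  filter_upwards [Filter.eventually_ge_atTop (3 * L),
    hshort.eventually_lt_const (half_pos hε)] with n hn hlt
  have hdis : Disjoint (Icc L (n - L)) s := by
    refine disjoint_left.2 fun d hd hds => ?_
    have : d ≤ s.sup id := le_sup (f := id) hds
    rw [mem_Icc] at hd
    omega
  have h₁ := (le_abs_self _).trans_lt (hs _ hdis)
  have h₂ := freq_long_bifix_le (by omega) hn
  have h₃ := freq_exists_le n (finite_len_le L).toFinset (fun ρ τ => ¬ ρ.OccursInside τ)
  have h₄ : freq n (fun τ => ∃ ρ : ConsecPerm, ρ.IsBifix τ ∧ ¬ ρ.OccursInside τ) ≤ _ :=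
    (freq_mono ?_).trans (freq_or_le n
      (fun τ => ∃ ρ ∈ (finite_len_le L).toFinset, ¬ ρ.OccursInside τ)
      (fun τ => ∃ ρ : ConsecPerm, L ≤ ρ.len ∧ ρ.IsBifix τ))
  · linarith
  · rintro τ - ⟨ρ, hb, ho⟩
    rcases le_total ρ.len L with h | h
    · exact .inl ⟨ρ, by simpa using h, ho⟩
    · exact .inr ⟨ρ, h, hb⟩

/-- At most `n!` permutations contain `σ`, so dividing by their number instead of `n!` can only
raise the ratio. -/
theorem one_sub_le_probContaining (σ : ConsecPerm) {n : ℕ} (hn : σ.len + 3 ≤ n) :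
    1 - ((freq n fun τ => ¬ σ.OccursInside τ) +
      freq n fun τ => ∃ ρ : ConsecPerm, ρ.IsBifix τ ∧ ¬ ρ.OccursInside τ) ≤
    probContaining σ n {τ | mobius σ τ = 0} := by
  have hn0 : 0 < n := by omega
  have h₁ : (1 : ℝ) ≤ freq n (fun τ => σ ≤ τ ∧ mobius σ τ = 0) +
      ((freq n fun τ => ¬ σ.OccursInside τ) +
        freq n fun τ => ∃ ρ : ConsecPerm, ρ.IsBifix τ ∧ ¬ ρ.OccursInside τ) := by
    refine le_trans ?_ (add_le_add le_rfl (freq_or_le _ _ _))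
    refine le_trans ?_ (freq_or_le _ _ _)
    rw [← freq_true hn0]
    refine freq_mono ?_
    rintro τ rfl -
    by_contra! h
    obtain ⟨h, ⟨j, -, -, hj⟩, hb⟩ := h
    exact h ⟨j, hj⟩ (mobius_eq_zero hn hb)
  suffices freq n (fun τ => σ ≤ τ ∧ mobius σ τ = 0) ≤
      probContaining σ n {τ | mobius σ τ = 0} by linarith
  have he : σ.containing n ∩ {τ | mobius σ τ = 0} =
      {τ | τ.len = n ∧ σ ≤ τ ∧ mobius σ τ = 0} := by
    ext τ; simp [containing, and_assoc]
  have hsub : (σ.containing n ∩ {τ | mobius σ τ = 0}).ncard ≤ (σ.containing n).ncard :=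
    Set.ncard_le_ncard Set.inter_subset_left (finite_containing σ n)
  have hle : ((σ.containing n).ncard : ℝ) ≤ n.factorial := by
    have h := freq_mono (n := n) (P := fun τ => σ ≤ τ) (Q := fun _ => True)
      fun _ _ _ => trivial
    rwa [freq_true hn0, freq, div_le_one (by positivity)] at h
  rw [probContaining, freq, ← he]
  -- If the denominator is `0`, so is the numerator, and both sides are `0`.
  rcases Nat.eq_zero_or_pos (σ.containing n).ncard with h0 | h0
  · rw [h0, Nat.le_zero] at hsub
    simp [hsub]
  · gcongr

end ConsecPerm

end

theorem corollary6p6 (σ : ConsecPerm) :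
    Filter.Tendsto
      (fun n : ℕ => ConsecPerm.probContaining σ n {τ | ConsecPerm.mobius σ τ = 0})
      Filter.atTop (nhds 1) := by
  have h := ((ConsecPerm.tendsto_freq_not_occursInside σ).add
    ConsecPerm.tendsto_freq_bifix_not_occursInside).const_sub 1
  rw [add_zero, sub_zero] at h
  refine tendsto_of_tendsto_of_tendsto_of_le_of_le' h tendsto_const_nhds ?_
    (.of_forall fun n => ?_)
  · filter_upwards [Filter.eventually_ge_atTop (σ.len + 3)] with n hn
    exact ConsecPerm.one_sub_le_probContaining σ hn
  · refine div_le_one_of_le₀ ?_ (Nat.cast_nonneg _)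
    exact_mod_cast Set.ncard_le_ncard Set.inter_subset_left (ConsecPerm.finite_containing σ n)
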